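/- **Setting.** A directed graph $\mathscr T=(V,\mathcal E)$ consists of a non-empty set $V$ and a set $\mathcal E\subseteq V\times V\setminus\{(v,v):v\in V\}$. A vertex $v$ is a root if $(u,v)\in\mathcal E$ for no $u\in V$, and $\mathsf{Chi}(u)=\{v:(u,v)\in\mathcal E\}$ is the set of children of $u$. $\mathscr T$ is a directed tree if it has no circuits (no distinct vertices $v_1,\dots,v_n$, $n\ge2$, with $(v_i,v_{i+1})\in\mathcal E$ for $1\le i<n$ and $(v_n,v_1)\in\mathcal E$), it is connected (as an undirected graph), and every vertex $v$ that is not a root has exactly one parent $\mathsf{par}(v)$, i.e. exactly one $u$ with $(u,v)\in\mathcal E$. It is rooted if it has a root (which is then unique), and leafless if every vertex has a child. In a rooted directed tree, $n_u$ denotes the number of edges of the directed path from the root to $u$, and the branching index is $k_{\mathscr T}=1+\sup\{n_w: \operatorname{card}\mathsf{Chi}(w)\ge 2\}\in\mathbb Z_+\cup\{\infty\}$, with $k_{\mathscr T}=0$ if no vertex has two children. Given positive weights $\{\lambda_v\}$, indexed by the non-root vertices, the weighted shift $S_\lambda$ on $\ell^2(V)$ is $(S_\lambda f)(v)=\lambda_v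 f(\mathsf{par}(v))$ if $v$ is not a root and $(S_\lambda f)(v)=0$ if $v$ is a root. We assume that it is a bounded operator on all of $\ell^2(V)$. If $S_\lambda$ is left-invertible (it has a bounded left inverse), then $S_\lambda^*S_\lambda$ is invertible, and $S_{\lambda'}:=S_\lambda(S_\lambda^*S_\lambda)^{-1}$ is the Cauchy dual of $S_\lambda$. Write $\mathbb D_\delta=\{z\in\mathbb C:|z|<\delta\}$. For $n\in\{1,2,\dots\}\cup\{\infty\}$ and a non-empty connected open set $\Omega\subseteq\mathbb C$, the Cowen–Douglas class $B_n(\Omega)$ consists of the bounded operators $T$ on a complex separable Hilbert space $\mathcal H$ such that 1. $\Omega\subseteq\sigma(T)$, 2. $\operatorname{ran}(T-w)=\mathcal H$ for every $w\in\Omega$, 3. the closed linear span of $\bigcup_{w\in\Omega}\ker(T-w)$ is $\mathcal H$, 4. $\dim\ker(T-w)=n$ for every $w\in\Omega$. **Corollary 5.7.** Let $\mathscr T$ be a countably infinite, leafless, rooted directed tree with finite branching index. Let $S_\lambda$ be a bounded left-invertible weighted shift on $\mathscr T$ with positive weights, let $S_{\lambda'}$ be its Cauchy dual, $E:=\ker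 S_\lambda^*$ and $\delta:=1/\|S_{\lambda'}\|$. Then $S_\lambda^*$ belongs to the Cowen–Douglas class $B_{\dim E}(\mathbb D_\delta)$, where $\dim E\in\{1,2,\dots\}\cup\{\infty\}$. -/

import Mathlib

noncomputable section

namespace WShift

/-! ### Directed trees -/

variable {V : Type*}

/-- A root of a directed graph: a vertex that is the end point of no edge. -/
def IsRoot (T : Digraph V) (v : V) : Prop := ∀ u, ¬ T.Adj u v

/-- A circuit: at least two distinct vertices `v 0, …, v n` (so `1 ≤ n`) with edges
`v 0 → v 1 → ⋯ → v n → v 0`. -/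
def HasCircuit (T : Digraph V) : Prop :=
  ∃ (n : ℕ) (v : ℕ → V), 1 ≤ n ∧ Set.InjOn v (Set.Iic n) ∧
    (∀ i < n, T.Adj (v i) (v (i + 1))) ∧ T.Adj (v n) (v 0)

/-- Directed trees: a non-empty vertex set, no loops, no circuits, connected (any two vertices are
joined by a finite path whose edges may be traversed in either direction), and every vertex that
is not a root has exactly one parent. -/
structure IsDirectedTree (T : Digraph V) : Prop where
  nonempty : Nonempty V
  loopless : ∀ v, ¬ T.Adj v v
  no_circuit : ¬ HasCircuit T
  connected : ∀ u v, Relation.ReflTransGen (fun a b => T.Adj a b ∨ T.Adj b a) u v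
  existsUnique_parent : ∀ v, ¬ IsRoot T v → ∃! u, T.Adj u v

/-- The set of children of the members of `W`. -/
def child (T : Digraph V) (W : Set V) : Set V := {v | ∃ u ∈ W, T.Adj u v}

/-- The `n`-th generation of descendants of the members of `W`. -/
def childn (T : Digraph V) : ℕ → Set V → Set V
  | 0, W => W
  | n + 1, W => child T (childn T n W)

/-- Every vertex has at least one child. -/
def IsLeafless (T : Digraph V) : Prop := ∀ u, (child T {u}).Nonempty

/-- The depth of `u`: the `n` with `u` in the `n`-th generation of the root `r`. In a directed tree
with root `r` there is exactly one such `n`. -/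
def depth (T : Digraph V) (r u : V) : ℕ := sInf {n | u ∈ childn T n {r}}

/-- The set of branching vertices, those with at least two children. -/
def branching (T : Digraph V) : Set V := {u | 2 ≤ (child T {u}).encard}

open Classical in
/-- The branching index of a directed tree with root `r`, a natural number or `∞`. -/
def branchingIndex (T : Digraph V) (r : V) : ℕ∞ :=
  if (branching T).Nonempty then 1 + ⨆ w ∈ branching T, (depth T r w : ℕ∞) else 0

open Classical in
/-- The parent of `v` (the vertex `v` itself, a value that is never used, if `v` is a root). -/
def parent (T : Digraph V) (v : V) : V := if h : ∃ u, T.Adj u v then h.choose else v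

/-! ### Weighted shifts -/

/-- The Hilbert space of square summable complex functions on `V`. -/
abbrev L2 (V : Type*) : Type _ := lp (fun _ : V => ℂ) 2

open Classical in
/-- The map on all complex functions on `V` that underlies the weighted shift with weights `lam`:
`f` goes to `v ↦ lam v * f (parent v)`, with value `0` at a root. The value of `lam` at a root
plays no role. -/
def shiftMap (T : Digraph V) (lam : V → ℝ) (f : V → ℂ) (v : V) : ℂ :=
  if IsRoot T v then 0 else (lam v : ℂ) * f (parent T v)

/-- The weighted shift with weights `lam` is defined on all of `ℓ²(V)`, is bounded, and is equal
to `S`. -/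
def IsWeightedShift (T : Digraph V) (lam : V → ℝ) (S : L2 V →L[ℂ] L2 V) : Prop :=
  ∀ f : L2 V, (S f : V → ℂ) = shiftMap T lam f

/-! ### Operators on a Hilbert space -/

variable {H : Type*} [NormedAddCommGroup H] [InnerProductSpace ℂ H] [CompleteSpace H]

/-- `A` has a bounded left inverse. -/
def IsLeftInvertible (A : H →L[ℂ] H) : Prop := ∃ B : H →L[ℂ] H, B * A = 1

/-- The Cauchy dual `A (A* A)⁻¹` of a left-invertible operator `A`; the inverse exists by
`isUnit_adjoint_mul_self`. -/
def cauchyDual (A : H →L[ℂ] H) : H →L[ℂ] H :=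
  A * Ring.inverse (ContinuousLinearMap.adjoint A * A)

/-- The kernel of a bounded operator. -/
def kernel (A : H →L[ℂ] H) : Submodule ℂ H := LinearMap.ker (A : H →ₗ[ℂ] H)

/-- The dimension of a subspace, in `ℕ ∪ {∞}`. On a closed subspace of a separable Hilbert space
this is the number of elements of an orthonormal basis, with `∞` standing for `ℵ₀`. -/
def dim (M : Submodule ℂ H) : ℕ∞ := Cardinal.toENat (Module.rank ℂ M)

/-- The Cowen–Douglas class `B_n(Ω)`, where `n` is a positive integer or `∞` and `Ω` is a
non-empty connected open subset of the plane (`H` being a separable Hilbert space). -/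
structure IsCowenDouglas (n : ℕ∞) (Ω : Set ℂ) (A : H →L[ℂ] H) : Prop where
  one_le : 1 ≤ n
  isOpen : IsOpen Ω
  isConnected : IsConnected Ω
  subset_spectrum : Ω ⊆ spectrum ℂ A
  surjective : ∀ w ∈ Ω, Function.Surjective (A - w • (1 : H →L[ℂ] H))
  span_dense : (⨆ w ∈ Ω, kernel (A - w • (1 : H →L[ℂ] H))).topologicalClosure = ⊤
  dim_kernel : ∀ w ∈ Ω, dim (kernel (A - w • (1 : H →L[ℂ] H))) = n

/-- If `A` is left-invertible then `A* A` is invertible. -/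
theorem isUnit_adjoint_mul_self {A : H →L[ℂ] H} (hA : IsLeftInvertible A) :
    IsUnit (ContinuousLinearMap.adjoint A * A) := by
  obtain ⟨B, hB⟩ := hA
  have hb : (0 : ℝ) < ‖B‖ + 1 := by positivity
  have hc : (0 : ℝ) < ((‖B‖ + 1) ^ 2)⁻¹ := by positivity
  refine ContinuousLinearMap.isUnit_of_forall_le_norm_inner_map _
    (c := ⟨((‖B‖ + 1) ^ 2)⁻¹, hc.le⟩) hc fun x => ?_
  have h1 : ‖x‖ ≤ (‖B‖ + 1) * ‖A x‖ := by
    have h2 : B (A x) = x := by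
      have := congrArg (fun F : H →L[ℂ] H => F x) hB
      simpa using this
    calc ‖x‖ = ‖B (A x)‖ := by rw [h2]
      _ ≤ ‖B‖ * ‖A x‖ := B.le_opNorm _
      _ ≤ (‖B‖ + 1) * ‖A x‖ := by gcongr; linarith
  have h3 : ‖inner ℂ ((ContinuousLinearMap.adjoint A * A) x) x‖ = ‖A x‖ ^ 2 := by
    rw [mul_apply_eq_comp, ContinuousLinearMap.adjoint_inner_left,
      inner_self_eq_norm_sq_to_K]
    simp
  rw [h3]
  have h4 : ‖x‖ ^ 2 ≤ (‖B‖ + 1) ^ 2 * ‖A x‖ ^ 2 := by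
    rw [← mul_pow]; gcongr
  change ‖x‖ ^ 2 * ((‖B‖ + 1) ^ 2)⁻¹ ≤ ‖A x‖ ^ 2
  rw [← div_eq_mul_inv, div_le_iff₀ (by positivity)]
  linarith

end WShift

end

noncomputable section

namespace WShift

/-! ### Left-invertible operators and their Cauchy duals -/

section Operators

open ContinuousLinearMap InnerProductSpace

variable {H : Type*} [NormedAddCommGroup H] [InnerProductSpace ℂ H] [CompleteSpace H]

/-! Let `B` be the Cauchy dual of `A`, so that `A* B = 1` and `A* - w = A* (1 - w B)`. For `|w| <
1/‖B‖` the second factor is invertible, so `A* - w` is onto and its kernel is `(1 - w B)⁻¹ ker A*`,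
of constant dimension. If `f` is orthogonal to all these kernels, then `w = 0` gives `f = A B* f`,
and `B* f` inherits the orthogonality (`inner_adjoint_ringInverse_eq_zero`). Iterating, `f` lies in
every `ran A ^ n`.

On a rooted tree these ranges meet only in `0`, because iterating the shift pushes supports away
from each vertex (`exists_forall_pow_apply_eq_zero`). The unit vector at the root makes `ker S*`
non-zero. -/

theorem mem_kernel {A : H →L[ℂ] H} {x : H} : x ∈ kernel A ↔ A x = 0 := Iff.rfl

/-- The Cauchy dual is a right inverse of the adjoint. -/
theorem adjoint_mul_cauchyDual {A : H →L[ℂ] H} (hA : IsLeftInvertible A) :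
    adjoint A * cauchyDual A = 1 := by
  rw [cauchyDual, ← mul_assoc, Ring.mul_inverse_cancel _ (isUnit_adjoint_mul_self hA)]

theorem cauchyDual_mul_adjoint_mul_self {A : H →L[ℂ] H} (hA : IsLeftInvertible A) :
    cauchyDual A * (adjoint A * A) = A := by
  rw [cauchyDual, mul_assoc, Ring.inverse_mul_cancel _ (isUnit_adjoint_mul_self hA), mul_one]

theorem adjoint_apply_cauchyDual {A : H →L[ℂ] H} (hA : IsLeftInvertible A) (x : H) :
    adjoint A (cauchyDual A x) = x :=
  congrArg (fun F : H →L[ℂ] H => F x) (adjoint_mul_cauchyDual hA)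

/-- The adjoint of `B A* A = A`. It puts `f - A B* f` in `ker A*`, so `A B*` is the orthogonal
projection onto `ran A`. -/
theorem adjoint_apply_apply_adjoint_cauchyDual {A : H →L[ℂ] H} (hA : IsLeftInvertible A) (x : H) :
    adjoint A (A (adjoint (cauchyDual A) x)) = adjoint A x := by
  refine ext_inner_left ℂ fun y => ?_
  have h : cauchyDual A (adjoint A (A y)) = A y :=
    congrArg (fun F : H →L[ℂ] H => F y) (cauchyDual_mul_adjoint_mul_self hA)
  rw [adjoint_inner_right, ← adjoint_inner_left, adjoint_inner_right, h, adjoint_inner_right]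

/-- A vector orthogonal to `ker A*` is in the range of `A`. -/
theorem apply_adjoint_cauchyDual_of_forall_inner_eq_zero {A : H →L[ℂ] H}
    (hA : IsLeftInvertible A) {f : H} (hf : ∀ x ∈ kernel (adjoint A), inner ℂ f x = 0) :
    A (adjoint (cauchyDual A) f) = f := by
  set g := adjoint (cauchyDual A) f
  have hk : adjoint A (f - A g) = 0 := by
    rw [map_sub, adjoint_apply_apply_adjoint_cauchyDual hA, sub_self]
  have h0 : inner ℂ (f - A g) (f - A g) = 0 := by
    rw [inner_sub_left, hf _ hk, ← adjoint_inner_right, hk, inner_zero_right, sub_zero]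
  exact (sub_eq_zero.mp (inner_self_eq_zero.mp h0)).symm

theorem isUnit_one_sub_smul {B : H →L[ℂ] H} {w : ℂ} (hw : w ∈ Metric.ball (0 : ℂ) (1 / ‖B‖)) :
    IsUnit (1 - w • B) := by
  refine isUnit_one_sub_of_norm_lt_one ?_
  rw [mem_ball_zero_iff] at hw
  -- If `‖B‖ = 0`, then `1 / ‖B‖ = 0` by convention and the ball is empty.
  have hB : 0 < ‖B‖ := by
    by_contra h
    have h' : ‖B‖ = 0 := le_antisymm (not_lt.mp h) (norm_nonneg _)
    rw [h', div_zero] at hw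
    exact absurd hw (not_lt.mpr (norm_nonneg _))
  rw [norm_smul]
  exact (lt_div_iff₀ hB).mp hw

/-- If `A B = 1` then `A (1 - w B) = A - w`. -/
theorem sub_smul_one_apply {A B : H →L[ℂ] H} (hAB : A * B = 1) (w : ℂ) (x : H) :
    A ((1 - w • B) x) = (A - w • (1 : H →L[ℂ] H)) x := by
  have h : A (B x) = x := congrArg (fun F : H →L[ℂ] H => F x) hAB
  simp [h]

theorem apply_ringInverse {R : H →L[ℂ] H} (hR : IsUnit R) (x : H) : R (Ring.inverse R x) = x :=
  congrArg (fun F : H →L[ℂ] H => F x) (Ring.mul_inverse_cancel _ hR)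

theorem ringInverse_apply {R : H →L[ℂ] H} (hR : IsUnit R) (x : H) : Ring.inverse R (R x) = x :=
  congrArg (fun F : H →L[ℂ] H => F x) (Ring.inverse_mul_cancel _ hR)

theorem surjective_sub_smul_one {A B : H →L[ℂ] H} (hAB : A * B = 1) {w : ℂ}
    (hw : w ∈ Metric.ball (0 : ℂ) (1 / ‖B‖)) :
    Function.Surjective (A - w • (1 : H →L[ℂ] H)) := by
  intro y
  -- Since `A B = 1`, `(A - w) B = 1 - w B`.
  refine ⟨B (Ring.inverse (1 - w • B) y), ?_⟩
  have h (z : H) : A (B z) = z := congrArg (fun F : H →L[ℂ] H => F z) hAB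
  have h' := apply_ringInverse (isUnit_one_sub_smul hw) y
  simpa [h] using h'

/-- If `A B = 1` then `1 - w B` maps `ker (A - w)` isomorphically onto `ker A`. -/
def kernelEquiv {A B : H →L[ℂ] H} (hAB : A * B = 1) {w : ℂ}
    (hw : w ∈ Metric.ball (0 : ℂ) (1 / ‖B‖)) :
    kernel (A - w • (1 : H →L[ℂ] H)) ≃ₗ[ℂ] kernel A where
  toFun x := ⟨(1 - w • B) x, by rw [mem_kernel, sub_smul_one_apply hAB]; exact x.2⟩
  invFun x := ⟨Ring.inverse (1 - w • B) x, by
    rw [mem_kernel, ← sub_smul_one_apply hAB, apply_ringInverse (isUnit_one_sub_smul hw)]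
    exact x.2⟩
  map_add' x y := Subtype.ext (map_add (1 - w • B) (x : H) y)
  map_smul' c x := Subtype.ext (map_smul (1 - w • B) c (x : H))
  left_inv x := Subtype.ext (ringInverse_apply (isUnit_one_sub_smul hw) _)
  right_inv x := Subtype.ext (apply_ringInverse (isUnit_one_sub_smul hw) _)

theorem dim_eq_of_linearEquiv {M N : Submodule ℂ H} (e : M ≃ₗ[ℂ] N) : dim M = dim N := by
  rw [dim, dim, e.rank_eq]

theorem one_le_dim {M : Submodule ℂ H} (hM : M ≠ ⊥) : 1 ≤ dim M := by
  rw [dim, Cardinal.one_le_toENat, Cardinal.one_le_iff_ne_zero]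
  exact fun h => hM (Submodule.rank_eq_zero.mp h)

theorem kernel_ne_bot_of_one_le_dim {M : Submodule ℂ H} (hM : 1 ≤ dim M) : M ≠ ⊥ := by
  rintro rfl
  simp [dim] at hM

/-- If `f` is orthogonal to `(1 - w B)⁻¹ x` for all `w` in a neighbourhood of `0`,
then so is `B* f`. -/
theorem inner_adjoint_ringInverse_eq_zero {B : H →L[ℂ] H} (hB : 0 < ‖B‖) {f x : H}
    (h : ∀ w ∈ Metric.ball (0 : ℂ) (1 / ‖B‖), inner ℂ f (Ring.inverse (1 - w • B) x) = 0) :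
    ∀ w ∈ Metric.ball (0 : ℂ) (1 / ‖B‖),
      inner ℂ (adjoint B f) (Ring.inverse (1 - w • B) x) = 0 := by
  have h0 : (0 : ℂ) ∈ Metric.ball (0 : ℂ) (1 / ‖B‖) := Metric.mem_ball_self (by positivity)
  have hfx : inner ℂ f x = 0 := by simpa using h 0 h0
  have hne : ∀ w ∈ Metric.ball (0 : ℂ) (1 / ‖B‖), w ≠ 0 →
      inner ℂ (adjoint B f) (Ring.inverse (1 - w • B) x) = 0 := by
    intro w hw hw0
    -- With `y = (1 - w B)⁻¹ x`, pairing `y - w B y = x` with `f` leaves `w ⟨f, B y⟩ = 0`.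
    have h1 := congrArg (inner ℂ f) (apply_ringInverse (isUnit_one_sub_smul hw) x)
    rw [hfx, _root_.sub_apply, _root_.smul_apply, inner_sub_right,
      inner_smul_right] at h1
    rw [adjoint_inner_left]
    have h2 := h w hw
    simpa [h2, hw0] using h1
  -- Division by `w` fails at `w = 0`; that value is recovered as a limit.
  have hcont : ContinuousAt
      (fun w : ℂ => inner ℂ (adjoint B f) (Ring.inverse (1 - w • B) x)) 0 := by
    have hin : ContinuousAt (fun w : ℂ => Ring.inverse (1 - w • B)) 0 := by
      obtain ⟨u, hu⟩ := isUnit_one_sub_smul h0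
      refine ContinuousAt.comp (g := Ring.inverse) (f := fun w : ℂ => 1 - w • B) ?_ (by fun_prop)
      rw [← hu]
      exact NormedRing.inverse_continuousAt u
    exact continuousAt_const.inner (hin.clm_apply continuousAt_const)
  intro w hw
  rcases eq_or_ne w 0 with rfl | hw0
  · refine tendsto_nhds_unique (f := fun w : ℂ => inner ℂ (adjoint B f) (Ring.inverse (1 - w • B) x))
      (l := nhdsWithin 0 {0}ᶜ) (hcont.tendsto.mono_left nhdsWithin_le_nhds) ?_
    refine tendsto_const_nhds.congr' ?_
    filter_upwards [self_mem_nhdsWithin,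
      nhdsWithin_le_nhds (Metric.isOpen_ball.mem_nhds h0)] with z hz hzb
    exact (hne z hzb hz).symm
  · exact hne w hw hw0

/-- The adjoint of a left-invertible operator `A` that is not surjective and satisfies
`⋂ n, ran (A ^ n) = 0` is a Cowen–Douglas operator. -/
theorem isCowenDouglas_adjoint {A : H →L[ℂ] H} (hA : IsLeftInvertible A)
    (hker : kernel (adjoint A) ≠ ⊥)
    (hanalytic : ∀ f : H, (∀ n : ℕ, ∃ g, (A ^ n) g = f) → f = 0) :
    IsCowenDouglas (dim (kernel (adjoint A))) (Metric.ball (0 : ℂ) (1 / ‖cauchyDual A‖))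
      (adjoint A) := by
  have hAB := adjoint_mul_cauchyDual hA
  -- `B = 0` together with `A* B = 1` would force `H = 0`.
  have hB : 0 < ‖cauchyDual A‖ := by
    refine norm_pos_iff.mpr fun h => ?_
    obtain ⟨x, -, hx⟩ := Submodule.exists_mem_ne_zero_of_ne_bot hker
    have := adjoint_apply_cauchyDual hA x
    rw [h] at this
    exact hx (by simpa using this.symm)
  have hdim : ∀ w ∈ Metric.ball (0 : ℂ) (1 / ‖cauchyDual A‖),
      dim (kernel (adjoint A - w • (1 : H →L[ℂ] H))) = dim (kernel (adjoint A)) :=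
    fun w hw => dim_eq_of_linearEquiv (kernelEquiv hAB hw)
  refine ⟨one_le_dim hker, Metric.isOpen_ball, ?_, fun w hw => ?_,
    fun w hw => surjective_sub_smul_one hAB hw, ?_, hdim⟩
  · exact (convex_ball _ _).isConnected ⟨0, Metric.mem_ball_self (by positivity)⟩
  · intro hres
    obtain ⟨x, hx, hx0⟩ := Submodule.exists_mem_ne_zero_of_ne_bot
      (kernel_ne_bot_of_one_le_dim ((one_le_dim hker).trans_eq (hdim w hw).symm))
    have hu : IsUnit (adjoint A - w • (1 : H →L[ℂ] H)) := by
      rw [← IsUnit.neg_iff, neg_sub, ← Algebra.algebraMap_eq_smul_one]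
      exact hres
    have h1 := ringInverse_apply hu x
    rw [mem_kernel.mp hx, map_zero] at h1
    exact hx0 h1.symm
  · rw [Submodule.topologicalClosure_eq_top_iff, Submodule.eq_bot_iff]
    intro f hf
    have hperp : ∀ x ∈ kernel (adjoint A), ∀ w ∈ Metric.ball (0 : ℂ) (1 / ‖cauchyDual A‖),
        inner ℂ f (Ring.inverse (1 - w • cauchyDual A) x) = 0 := fun x hx w hw =>
      (Submodule.mem_orthogonal' _ _).mp hf _
        ((le_iSup₂_of_le (f := fun w _ => kernel (adjoint A - w • (1 : H →L[ℂ] H))) w hw le_rfl)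
          ((kernelEquiv hAB hw).symm ⟨x, hx⟩).2)
    -- The preimage under `A ^ n` comes from iterating `f = A B* f`. The induction varies `f`,
    -- carrying only the orthogonality `hperp`.
    refine hanalytic f fun n => ⟨(adjoint (cauchyDual A) ^ n) f, ?_⟩
    clear hf
    induction n generalizing f with
    | zero => rfl
    | succ n ih =>
      have h := ih (adjoint (cauchyDual A) f) fun x hx =>
        inner_adjoint_ringInverse_eq_zero hB (hperp x hx)
      rw [pow_succ', pow_succ]
      refine (congrArg A h).trans (apply_adjoint_cauchyDual_of_forall_inner_eq_zero hA ?_)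
      intro x hx
      simpa using hperp x hx 0 (Metric.mem_ball_self (by positivity))

end Operators

/-! ### Weighted shifts on directed trees -/

section Shifts

open ContinuousLinearMap

variable {V : Type*} {T : Digraph V} {lam : V → ℝ} {S : L2 V →L[ℂ] L2 V}

theorem parent_eq (hT : IsDirectedTree T) {u v : V} (h : T.Adj u v) : parent T v = u := by
  have hex : ∃ u, T.Adj u v := ⟨u, h⟩
  rw [parent, dif_pos hex]
  exact (hT.existsUnique_parent v fun hv => hv u h).unique hex.choose_spec h

theorem IsWeightedShift.apply_root (hS : IsWeightedShift T lam S) {r : V} (hr : IsRoot T r)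
    (f : L2 V) : S f r = 0 := by
  rw [hS f, shiftMap, if_pos hr]

theorem IsWeightedShift.apply_of_adj (hS : IsWeightedShift T lam S) (hT : IsDirectedTree T)
    {u v : V} (h : T.Adj u v) (f : L2 V) : S f v = lam v * f u := by
  rw [hS f, shiftMap, if_neg fun hv => hv u h, parent_eq hT h]

/-- The functions in the range of a large power of a weighted shift vanish at a given vertex. -/
theorem IsWeightedShift.exists_forall_pow_apply_eq_zero (hS : IsWeightedShift T lam S)
    (hT : IsDirectedTree T) {r : V} (hr : IsRoot T r) (hlam : ∀ v, ¬ IsRoot T v → 0 < lam v)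
    (v : V) : ∃ N : ℕ, ∀ n ≥ N, ∀ g : L2 V, (S ^ n) g v = 0 := by
  have hsucc (n : ℕ) (g : L2 V) : (S ^ (n + 1)) g = S ((S ^ n) g) := by rw [pow_succ']; rfl
  induction hT.connected r v with
  | refl =>
    refine ⟨1, fun n hn g => ?_⟩
    obtain ⟨m, rfl⟩ := Nat.exists_eq_add_of_le' hn
    rw [hsucc, hS.apply_root hr]
  | @tail a b _ hab ih =>
    obtain ⟨N, hN⟩ := ih
    -- Along an edge from `a` to `b` the threshold grows by one. Against an edge it is kept: `(S ^
    -- (n + 1) g) a` is the non-zero weight `lam a` times `(S ^ n g) b`.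
    rcases hab with hab | hba
    · refine ⟨N + 1, fun n hn g => ?_⟩
      obtain ⟨m, rfl⟩ := Nat.exists_eq_add_of_le' (Nat.le_of_add_left_le hn)
      rw [hsucc, hS.apply_of_adj hT hab, hN m (by omega), mul_zero]
    · refine ⟨N, fun n hn g => ?_⟩
      have h := hN (n + 1) (by omega) g
      rw [hsucc, hS.apply_of_adj hT hba] at h
      exact (mul_eq_zero.mp h).resolve_left
        (Complex.ofReal_ne_zero.mpr (hlam a fun ha => ha b hba).ne')

/-- The range of a weighted shift is orthogonal to the unit vector at a root. -/
theorem IsWeightedShift.kernel_adjoint_ne_bot (hS : IsWeightedShift T lam S) {r : V}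
    (hr : IsRoot T r) : kernel (adjoint S) ≠ ⊥ := by
  classical
  refine (Submodule.ne_bot_iff _).mpr ⟨lp.single 2 r (1 : ℂ), ?_, ?_⟩
  · refine ext_inner_right ℂ fun f => ?_
    rw [inner_zero_left]
    refine (adjoint_inner_left S f _).trans ?_
    rw [lp.inner_single_left, hS.apply_root hr, inner_zero_right]
  · intro h
    have h1 := congrArg (fun f : L2 V => f r) h
    simp at h1

end Shifts

end WShift

end

theorem corollary5p7 {V : Type*} [Countable V] [Infinite V]
    (T : Digraph V) (hT : WShift.IsDirectedTree T) (hleaf : WShift.IsLeafless T)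
    (r : V) (hr : WShift.IsRoot T r) (hk : WShift.branchingIndex T r < ⊤)
    (lam : V → ℝ) (hlam : ∀ v, ¬ WShift.IsRoot T v → 0 < lam v)
    (S : WShift.L2 V →L[ℂ] WShift.L2 V) (hS : WShift.IsWeightedShift T lam S)
    (hinv : WShift.IsLeftInvertible S) :
    WShift.IsCowenDouglas
      (WShift.dim (WShift.kernel (ContinuousLinearMap.adjoint S)))
      (Metric.ball (0 : ℂ) (1 / ‖WShift.cauchyDual S‖))
      (ContinuousLinearMap.adjoint S) :=
  WShift.isCowenDouglas_adjoint hinv (hS.kernel_adjoint_ne_bot hr) fun f hf => by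
    ext v
    obtain ⟨N, hN⟩ := hS.exists_forall_pow_apply_eq_zero hT hr hlam v
    obtain ⟨g, rfl⟩ := hf N
    exact hN N le_rfl g
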